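/- Fix a set $C$ of colours. A \emph{hypergraph} is a pair $H=(V,E)$ with $V$ a finite set of vertices and $E$ a finite set of edges, where an edge is a tuple $(v_1,\dots,v_r;c)$ of $r\ge 2$ distinct vertices $v_i\in V$ together with a colour $c\in C$. Isomorphisms are bijections of the vertex sets that preserve and reflect edges with their direction and colour. For $U\subseteq V$, $H[U]$ is the hypergraph on $U$ whose edges are the edges of $H$ with all vertices in $U$; $G\le H$ means that $G$ is isomorphic to some $H[U]$; $kG$ is the disjoint union of $k$ copies of $G$; and $K_1$ is the hypergraph with one vertex and no edge. For hypergraphs $G_1,\dots,G_n$ with disjoint vertex sets, $G_1*\cdots*G_n$ is the set of all hypergraphs $H$ with $V(H)=\bigcup_i V(G_i)$ and $H[V(G_i)]=G_i$ for all $i$. An \emph{additive induced-hereditary property} is an isomorphism-closed class $\mathcal P$ of hypergraphs that contains some hypergraph with at least one vertex, that is closed under disjoint unions, and that contains $G$ whenever $G\le H\in\mathcal P$ (so it contains the null hypergraph). The product $\mathcal P_1\circ\cdots\circ\mathcal P_n$ is the class of all $H$ whose vertex set has a partition $(V_1,\dots,V_n)$ into possibly empty parts with $H[V_i]\in\mathcal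 P_i$ for all $i$. A \emph{$\mathcal P$-decomposition} of $G$ with $n$ parts is a partition $(V_1,\dots,V_n)$ of $V(G)$ into nonempty parts such that $kG[V_1]*\cdots*kG[V_n]\subseteq\mathcal P$ for all integers $k\ge1$. For $G\in\mathcal P$, $dec_{\mathcal P}(G)$ is the maximum number of parts in a $\mathcal P$-decomposition of $G$, and $dec_{\mathcal P}(G)=0$ for $G\notin\mathcal P$. A hypergraph $G$ is \emph{$\mathcal P$-strict} if $G\in\mathcal P$ but $G*K_1\not\subseteq\mathcal P$. Put $dec(\mathcal P)=\min\{dec_{\mathcal P}(G): G \text{ is } \mathcal P\text{-strict}\}$, and call $\mathcal P$ \emph{indecomposable} if $dec(\mathcal P)=1$. \textbf{Theorem.} Let $\mathcal P$ be an additive induced-hereditary property that is not the class of all hypergraphs, and let $n=dec(\mathcal P)$. Then there are additive induced-hereditary properties $\mathcal P_1,\dots,\mathcal P_n$, each of them indecomposable, such that $\mathcal P=\mathcal P_1\circ\cdots\circ\mathcal P_n$. Moreover, whenever $\mathcal P=\mathcal Q_1\circ\cdots\circ\mathcal Q_n$ with additive induced-hereditary properties $\mathcal Q_1,\dots,\mathcal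 Q_n$, every $\mathcal Q_i$ is indecomposable. -/

import Mathlib

/-- A finite directed hypergraph with edges coloured by `C`.  An edge is an ordered tuple of
at least two distinct vertices together with a colour; the edges form a finite set, so there are
no loops and no repeated edges. -/
structure DirHypergraph (C : Type*) where
  V : Type
  finite_V : Finite V
  E : Set (List V × C)
  finite_E : E.Finite
  nodup : ∀ e ∈ E, e.1.Nodup
  two_le_length : ∀ e ∈ E, 2 ≤ e.1.length

namespace DirHypergraph

variable {C : Type*}

/-- The image of a coloured tuple under a map of the vertices. -/
def mapEdge {V W : Type} (f : V → W) (e : List V × C) : List W × C := (e.1.map f, e.2)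

theorem mapEdge_injective {V W : Type} {f : V → W} (hf : Function.Injective f) :
    Function.Injective (mapEdge f : List V × C → List W × C) := by
  rintro ⟨a, c⟩ ⟨b, d⟩ h
  simp only [mapEdge, Prod.mk.injEq] at h
  obtain ⟨h1, h2⟩ := h
  rw [List.map_injective_iff.mpr hf h1, h2]

/-- `φ` is an isomorphism: a bijection of the vertices that preserves and reflects edges,
together with their direction and colour. -/
def IsIso (G H : DirHypergraph C) (φ : G.V ≃ H.V) : Prop :=
  ∀ e : List G.V × C, e ∈ G.E ↔ mapEdge φ e ∈ H.E

/-- The subhypergraph `H[U]` induced by a set `U` of vertices: its edges are the edges of `H` all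
of whose vertices lie in `U`. -/
def induce (H : DirHypergraph C) (U : Set H.V) : DirHypergraph C where
  V := U
  finite_V := have := H.finite_V; inferInstance
  E := {e | mapEdge Subtype.val e ∈ H.E}
  finite_E := H.finite_E.preimage (mapEdge_injective Subtype.val_injective).injOn
  nodup e he := (H.nodup _ he).of_map _
  two_le_length e he := by simpa [mapEdge] using H.two_le_length _ he

/-- `G ≤ H`: `G` is isomorphic to some induced subhypergraph of `H`. -/
def IsInducedSub (G H : DirHypergraph C) : Prop :=
  ∃ (U : Set H.V) (φ : G.V ≃ (H.induce U).V), IsIso G (H.induce U) φ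

/-- The disjoint union of two hypergraphs. -/
def disjUnion (G H : DirHypergraph C) : DirHypergraph C where
  V := G.V ⊕ H.V
  finite_V := have := G.finite_V; have := H.finite_V; inferInstance
  E := mapEdge Sum.inl '' G.E ∪ mapEdge Sum.inr '' H.E
  finite_E := (G.finite_E.image _).union (H.finite_E.image _)
  nodup := by
    rintro _ (⟨e, he, rfl⟩ | ⟨e, he, rfl⟩)
    · exact (G.nodup e he).map Sum.inl_injective
    · exact (H.nodup e he).map Sum.inr_injective
  two_le_length := by
    rintro _ (⟨e, he, rfl⟩ | ⟨e, he, rfl⟩)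
    · simpa [mapEdge] using G.two_le_length e he
    · simpa [mapEdge] using H.two_le_length e he

/-- `kG`: the disjoint union of `k` copies of `G`. -/
def copies (k : ℕ) (G : DirHypergraph C) : DirHypergraph C where
  V := Fin k × G.V
  finite_V := have := G.finite_V; inferInstance
  E := ⋃ j : Fin k, mapEdge (Prod.mk j) '' G.E
  finite_E := Set.finite_iUnion fun _ => G.finite_E.image _
  nodup := by
    intro e he
    obtain ⟨j, e, h, rfl⟩ := Set.mem_iUnion.mp he
    exact (G.nodup e h).map (Prod.mk_right_injective j)
  two_le_length := by
    intro e he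
    obtain ⟨j, e, h, rfl⟩ := Set.mem_iUnion.mp he
    simpa [mapEdge] using G.two_le_length e h

/-- `K₁`: one vertex and no edge. -/
def single (C : Type*) : DirHypergraph C where
  V := Unit
  finite_V := inferInstance
  E := ∅
  finite_E := Set.finite_empty
  nodup := by simp
  two_le_length := by simp

/-- The `*`-join of a family of hypergraphs, up to isomorphism: all hypergraphs `H` whose vertex
set is the disjoint union of the vertex sets of the `K i`, such that the subhypergraph of `H`
induced by the vertices of `K i` is exactly `K i`.  Edges of `H` that meet at least two of the
pieces are arbitrary. -/
def starJoin {ι : Type} (K : ι → DirHypergraph C) : Set (DirHypergraph C) :=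
  {H | ∃ φ : (Σ i, (K i).V) ≃ H.V,
    ∀ (i : ι) (e : List (K i).V × C), e ∈ (K i).E ↔ mapEdge (fun v => φ ⟨i, v⟩) e ∈ H.E}

/-- An additive induced-hereditary property of hypergraphs. -/
structure IsAdditiveIndHer (P : Set (DirHypergraph C)) : Prop where
  /-- `P` contains a hypergraph other than the null hypergraph. -/
  nontrivial : ∃ G ∈ P, Nonempty G.V
  iso_closed : ∀ (G H : DirHypergraph C) (φ : G.V ≃ H.V), IsIso G H φ → G ∈ P → H ∈ P
  hereditary : ∀ G H : DirHypergraph C, IsInducedSub G H → H ∈ P → G ∈ P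
  additive : ∀ G H : DirHypergraph C, G ∈ P → H ∈ P → disjUnion G H ∈ P

/-- The product `Q₁ ∘ ⋯ ∘ Qₙ`: the hypergraphs whose vertex set has a partition into `n` (possibly
empty) parts such that the `i`-th part induces a hypergraph in `Q i`.  A partition is given by the
function `c` that sends a vertex to the index of its part. -/
def product {n : ℕ} (Q : Fin n → Set (DirHypergraph C)) : Set (DirHypergraph C) :=
  {G | ∃ c : G.V → Fin n, ∀ i, G.induce (c ⁻¹' {i}) ∈ Q i}

/-- A `P`-decomposition of `G` with `n` parts: a partition of the vertices into `n` nonempty parts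
`V₁, …, Vₙ` such that `kG[V₁] * ⋯ * kG[Vₙ] ⊆ P` for all positive integers `k`. -/
def IsDecomposition (P : Set (DirHypergraph C)) (G : DirHypergraph C) {n : ℕ}
    (c : G.V → Fin n) : Prop :=
  (∀ i, (c ⁻¹' {i}).Nonempty) ∧
    ∀ k : ℕ, 0 < k → starJoin (fun i => copies k (G.induce (c ⁻¹' {i}))) ⊆ P

/-- `dec_P(G)`: the maximum number of parts in a `P`-decomposition of `G`.  The number of parts is
at most the number of vertices; if `G ∉ P` there is no decomposition and the value is `0`. -/
noncomputable def decNumber (P : Set (DirHypergraph C)) (G : DirHypergraph C) : ℕ :=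
  sSup {n : ℕ | ∃ c : G.V → Fin n, IsDecomposition P G c}

/-- The `P`-strict hypergraphs: those `G ∈ P` with `G * K₁ ⊄ P`. -/
def strict (P : Set (DirHypergraph C)) : Set (DirHypergraph C) :=
  {G | G ∈ P ∧ ¬ starJoin ![G, single C] ⊆ P}

/-- `dec(P)`: the minimum of `dec_P(G)` over all `P`-strict hypergraphs `G`. -/
noncomputable def dec (P : Set (DirHypergraph C)) : ℕ :=
  sInf (decNumber P '' strict P)

/-- `P` is indecomposable if `dec(P) = 1`. -/
def Indecomposable (P : Set (DirHypergraph C)) : Prop := dec P = 1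

end DirHypergraph

namespace DirHypergraph

variable {C : Type*}

/-! For a class closed under embeddings, containing every `*`-join of the `H i` amounts to
containing the product of the classes `Below (H i)` (`starJoin_subset_iff`), so a decomposition is a
factorisation seen on a single hypergraph.

A factorisation of `P` into m additive induced-hereditary properties induces on every strict
hypergraph a decomposition with m parts. No part is empty, since a spare colour could absorb an
arbitrarily attached vertex (`surjective_of_strict`). Hence m ≤ `dec P` (`card_le_dec`).

Conversely, above a strict hypergraph attaining the minimum, every member of `P` has a decomposition
with exactly `dec P` parts (`exists_strict_dec`). Additivity makes `P` directed under embedding, so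
compactness yields coherent colourings of all members of `P` (`exists_coherent_colouring`). Let the
i-th factor be generated by the parts of colour i. A hypergraph in the product involves only
finitely many generators, which all sit inside the parts of one decomposed hypergraph. The parts of
the product hypergraph then embed into copies of those parts, which puts it in `P`.

Finally, if `P` is the product of `dec P` properties `Q i`, factor each `Q i` into `dec (Q i)`
properties. The total number of factors is at most `dec P`, while each `dec (Q i)` is at least 1, so
all equal 1. -/

/-- `f` is an embedding of `G` onto an induced subhypergraph of `H`. -/
def IsEmb (G H : DirHypergraph C) (f : G.V → H.V) : Prop :=
  Function.Injective f ∧ ∀ e : List G.V × C, e ∈ G.E ↔ mapEdge f e ∈ H.E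

/-- The class of hypergraphs that embed into `H`. -/
def Below (H : DirHypergraph C) : Set (DirHypergraph C) := {G | ∃ f, IsEmb G H f}

/-- The product of a family of classes over an arbitrary index type. -/
def genProduct {ι : Type} (Q : ι → Set (DirHypergraph C)) : Set (DirHypergraph C) :=
  {G | ∃ c : G.V → ι, ∀ i, G.induce (c ⁻¹' {i}) ∈ Q i}

/-- Closure of a class under taking embedded hypergraphs. -/
def EmbClosed (P : Set (DirHypergraph C)) : Prop :=
  ∀ ⦃G H : DirHypergraph C⦄ ⦃f : G.V → H.V⦄, IsEmb G H f → H ∈ P → G ∈ P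

/-! ### Embeddings and induced subhypergraphs -/

theorem mapEdge_mapEdge {U V W : Type} (f : V → W) (g : U → V) (e : List U × C) :
    mapEdge f (mapEdge g e) = mapEdge (f ∘ g) e := by
  simp [mapEdge]

theorem mapEdge_id {V : Type} (e : List V × C) : mapEdge id e = e := by
  simp [mapEdge]

theorem mapEdge_mapEdge_eq {U V V' W : Type} {f : V → W} {g : U → V} {f' : V' → W} {g' : U → V'}
    (h : f ∘ g = f' ∘ g') (e : List U × C) :
    mapEdge f (mapEdge g e) = mapEdge f' (mapEdge g' e) := by
  rw [mapEdge_mapEdge, mapEdge_mapEdge, h]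

theorem exists_mapEdge_eq {V W : Type} {f : V → W} {e : List W × C}
    (h : ∀ w ∈ e.1, w ∈ Set.range f) : ∃ e' : List V × C, mapEdge f e' = e := by
  obtain ⟨l, hl⟩ := (Set.range_list_map f).superset h
  exact ⟨(l, e.2), Prod.ext hl rfl⟩

theorem ne_nil_of_mem {G : DirHypergraph C} {e : List G.V × C} (h : e ∈ G.E) : e.1 ≠ [] := by
  intro h'
  have := G.two_le_length e h
  simp [h'] at this

theorem IsEmb.refl (G : DirHypergraph C) : IsEmb G G id :=
  ⟨Function.injective_id, fun e => by rw [mapEdge_id]⟩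

theorem IsEmb.comp {G H K : DirHypergraph C} {g : H.V → K.V} {f : G.V → H.V}
    (hg : IsEmb H K g) (hf : IsEmb G H f) : IsEmb G K (g ∘ f) :=
  ⟨hg.1.comp hf.1, fun e => by rw [hf.2, hg.2, mapEdge_mapEdge]⟩

theorem IsIso.isEmb {G H : DirHypergraph C} {φ : G.V ≃ H.V} (h : IsIso G H φ) : IsEmb G H φ :=
  ⟨φ.injective, h⟩

theorem IsIso.isEmb_symm {G H : DirHypergraph C} {φ : G.V ≃ H.V} (h : IsIso G H φ) :
    IsEmb H G φ.symm :=
  ⟨φ.symm.injective, fun e => by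
    rw [h, mapEdge_mapEdge, Equiv.self_comp_symm, mapEdge_id]⟩

theorem isEmb_val (H : DirHypergraph C) (U : Set H.V) : IsEmb (H.induce U) H Subtype.val :=
  ⟨Subtype.val_injective, fun _ => Iff.rfl⟩

theorem IsEmb.induce {G H : DirHypergraph C} {f : G.V → H.V} (hf : IsEmb G H f)
    {A : Set G.V} {B : Set H.V} (h : Set.MapsTo f A B) :
    IsEmb (G.induce A) (H.induce B) (h.restrict f A B) := by
  refine ⟨h.restrict_inj.mpr hf.1.injOn, fun e => ?_⟩
  refine (hf.2 (mapEdge Subtype.val e)).trans (iff_of_eq (congrArg (· ∈ H.E) ?_))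
  exact mapEdge_mapEdge_eq (f := f) (g := Subtype.val) (f' := Subtype.val)
    (g' := h.restrict f A B) rfl e

theorem isEmb_of_comp {G H : DirHypergraph C} {B : Set H.V} {f : G.V → (H.induce B).V}
    (hf : IsEmb G H (Subtype.val ∘ f)) : IsEmb G (H.induce B) f := by
  refine ⟨hf.1.of_comp, fun e => ?_⟩
  refine (hf.2 e).trans (iff_of_eq (congrArg (· ∈ H.E) ?_))
  exact (mapEdge_mapEdge (Subtype.val : B → H.V) f e).symm

theorem IsEmb.codRestrict {G H : DirHypergraph C} {f : G.V → H.V} (hf : IsEmb G H f)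
    {B : Set H.V} (h : ∀ v, f v ∈ B) :
    IsEmb G (H.induce B) (fun v => ⟨f v, h v⟩) := isEmb_of_comp hf

theorem isInducedSub_iff {G H : DirHypergraph C} : IsInducedSub G H ↔ G ∈ Below H := by
  constructor
  · rintro ⟨U, φ, h⟩
    exact ⟨_, (isEmb_val H U).comp h.isEmb⟩
  · rintro ⟨f, hf⟩
    refine ⟨Set.range f, Equiv.ofInjective f hf.1, fun e => ?_⟩
    refine (hf.2 e).trans (iff_of_eq (congrArg (· ∈ H.E) ?_))
    exact (mapEdge_mapEdge Subtype.val (Equiv.ofInjective f hf.1) e).symm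

theorem IsAdditiveIndHer.embClosed {P : Set (DirHypergraph C)} (hP : IsAdditiveIndHer P) :
    EmbClosed P := fun G H f hf hH => hP.hereditary G H (isInducedSub_iff.mpr ⟨f, hf⟩) hH

theorem embClosed_Below (H : DirHypergraph C) : EmbClosed (Below H) := by
  rintro G K f hf ⟨g, hg⟩
  exact ⟨_, hg.comp hf⟩

theorem Below_subset {P : Set (DirHypergraph C)} (hP : EmbClosed P) {H : DirHypergraph C}
    (hH : H ∈ P) : Below H ⊆ P := fun _ ⟨_, hf⟩ => hP hf hH

theorem isEmb_single {H : DirHypergraph C} (v : H.V) : IsEmb (single C) H fun _ => v := by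
  refine ⟨fun _ _ _ => rfl, fun e => ⟨fun h => h.elim, fun h => ?_⟩⟩
  have h1 := H.nodup _ h
  have h2 := H.two_le_length _ h
  obtain ⟨l, c⟩ := e
  -- A constant tuple either has length below 2 or repeats its vertex, so it is never an edge.
  match l, h1, h2 with
  | [], _, h2 => simp [mapEdge] at h2
  | [_], _, h2 => simp [mapEdge] at h2
  | _ :: _ :: _, h1, _ => simp [mapEdge] at h1

theorem isEmb_of_isEmpty {G H : DirHypergraph C} [IsEmpty G.V] : IsEmb G H isEmptyElim := by
  refine ⟨fun x => isEmptyElim x, fun e => ?_⟩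
  obtain ⟨l, c⟩ := e
  cases l with
  | nil => exact ⟨fun h => (ne_nil_of_mem h rfl).elim, fun h => (ne_nil_of_mem h rfl).elim⟩
  | cons a l => exact isEmptyElim a

theorem IsAdditiveIndHer.single_mem {P : Set (DirHypergraph C)} (hP : IsAdditiveIndHer P) :
    single C ∈ P := by
  obtain ⟨G, hG, ⟨v⟩⟩ := hP.nontrivial
  exact hP.embClosed (isEmb_single v) hG

theorem IsAdditiveIndHer.mem_of_isEmpty {P : Set (DirHypergraph C)} (hP : IsAdditiveIndHer P)
    {G : DirHypergraph C} (h : IsEmpty G.V) : G ∈ P :=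
  hP.embClosed isEmb_of_isEmpty hP.single_mem

/-! ### Products -/

theorem genProduct_mono {ι : Type} {Q R : ι → Set (DirHypergraph C)} (h : ∀ i, Q i ⊆ R i) :
    genProduct Q ⊆ genProduct R := fun _ ⟨c, hc⟩ => ⟨c, fun i => h i (hc i)⟩

theorem genProduct_comp_equiv {ι κ : Type} (σ : ι ≃ κ) (Q : κ → Set (DirHypergraph C)) :
    genProduct (fun i => Q (σ i)) = genProduct Q := by
  ext G
  constructor
  · rintro ⟨c, hc⟩
    refine ⟨σ ∘ c, fun i => ?_⟩
    have : (σ ∘ c) ⁻¹' {i} = c ⁻¹' {σ.symm i} := by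
      ext v; simp [Equiv.eq_symm_apply]
    rw [this]
    simpa using hc (σ.symm i)
  · rintro ⟨c, hc⟩
    refine ⟨σ.symm ∘ c, fun i => ?_⟩
    have : (σ.symm ∘ c) ⁻¹' {i} = c ⁻¹' {σ i} := by
      ext v; simp [Equiv.symm_apply_eq]
    rw [this]
    exact hc (σ i)

theorem genProduct_const {P : Set (DirHypergraph C)} (hP : EmbClosed P) :
    genProduct (fun _ : Unit => P) = P := by
  ext G
  constructor
  · rintro ⟨c, hc⟩
    exact hP ((IsEmb.refl G).codRestrict (B := c ⁻¹' {()}) fun _ => rfl) (hc ())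
  · exact fun hG => ⟨fun _ => (), fun _ => hP (isEmb_val _ _) hG⟩

/-- Splitting every factor of a product gives one product over all the subfactors; this is what lets
factorisations be refined and their factors counted. -/
theorem genProduct_sigma {ι : Type} {κ : ι → Type}
    (R : ∀ i, κ i → Set (DirHypergraph C)) (hR : ∀ i j, EmbClosed (R i j)) :
    genProduct (fun x : Σ i, κ i => R x.1 x.2) = genProduct (fun i => genProduct (R i)) := by
  ext G
  constructor
  · rintro ⟨c, hc⟩
    refine ⟨fun v => (c v).1, fun i => ⟨fun v => cast (congrArg κ v.2) (c v.1).2, fun j => ?_⟩⟩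
    refine hR i j (((isEmb_val G _).comp (isEmb_val (G.induce _) _)).codRestrict
      (B := c ⁻¹' {⟨i, j⟩}) ?_) (hc ⟨i, j⟩)
    rintro ⟨⟨v, hv⟩, hv'⟩
    change c v = ⟨i, j⟩
    change (c v).1 = i at hv
    subst hv
    change (c v).2 = j at hv'
    subst hv'
    rfl
  · rintro ⟨c, hc⟩
    choose d hd using hc
    refine ⟨fun v => ⟨c v, d (c v) ⟨v, rfl⟩⟩, ?_⟩
    rintro ⟨i, j⟩
    have h1 : ∀ v : (G.induce ((fun v => (⟨c v, d (c v) ⟨v, rfl⟩⟩ : Σ i, κ i)) ⁻¹'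
        {⟨i, j⟩})).V, ∃ h : c v.1 = i, d i ⟨v.1, h⟩ = j := by
      rintro ⟨v, hv⟩
      have hv : (⟨c v, d (c v) ⟨v, rfl⟩⟩ : Σ i, κ i) = ⟨i, j⟩ := hv
      obtain ⟨h, h'⟩ := Sigma.mk.inj_iff.mp hv
      subst h
      exact ⟨rfl, eq_of_heq h'⟩
    exact hR i j (((isEmb_val G _).codRestrict (B := c ⁻¹' {i}) fun v => (h1 v).1).codRestrict
      (B := d i ⁻¹' {j}) fun v => (h1 v).2) (hd i j)

/-- Every hypergraph whose parts embed into the `H i` embeds into a member of their `*`-join. -/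
theorem exists_mem_starJoin {ι : Type} [Finite ι] {H : ι → DirHypergraph C}
    {K : DirHypergraph C} (hK : K ∈ genProduct fun i => Below (H i)) :
    ∃ L ∈ starJoin H, K ∈ Below L := by
  obtain ⟨d, hd⟩ := hK
  choose f hf using hd
  let F : K.V → Σ i, (H i).V := fun v => ⟨d v, f (d v) ⟨v, rfl⟩⟩
  have hF : ∀ i (v : (K.induce (d ⁻¹' {i})).V), F v.1 = ⟨i, f i v⟩ := by
    rintro _ ⟨v, rfl⟩
    rfl
  have hF' : ∀ i (e : List (K.induce (d ⁻¹' {i})).V × C),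
      mapEdge F (mapEdge Subtype.val e) = mapEdge (Sigma.mk i) (mapEdge (f i) e) := by
    exact fun i e => mapEdge_mapEdge_eq (funext (hF i)) e
  have hFinj : Function.Injective F := by
    intro v w h
    have h1 : d v = d w := congrArg Sigma.fst h
    have h2 : F w = ⟨d v, f (d v) ⟨w, h1.symm⟩⟩ := hF (d v) ⟨w, h1.symm⟩
    exact congrArg Subtype.val ((hf (d v)).1 (sigma_mk_injective (β := fun i => (H i).V) (h.trans h2)))
  -- A tuple of `K` mapped into the i-th piece has all its vertices of colour `i`, so `f i` decides
  -- whether it is an edge. Hence the two sources of edges of `L` below never conflict.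
  have key : ∀ i (e : List K.V × C) (e' : List (H i).V × C),
      mapEdge F e = mapEdge (Sigma.mk i) e' → (e ∈ K.E ↔ e' ∈ (H i).E) := by
    intro i e e' h
    have h1 : ∀ v ∈ e.1, v ∈ d ⁻¹' {i} := by
      intro v hv
      have : F v ∈ (mapEdge F e).1 := List.mem_map_of_mem hv
      rw [h] at this
      obtain ⟨x, -, hx⟩ := List.mem_map.mp this
      exact (congrArg Sigma.fst hx).symm
    obtain ⟨e0, rfl⟩ := exists_mapEdge_eq (f := (Subtype.val : d ⁻¹' {i} → K.V)) (by simpa using h1)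
    rw [← mapEdge_injective sigma_mk_injective ((hF' i e0).symm.trans h)]
    exact (hf i).2 e0
  -- The pieces `H i` side by side, with only those crossing edges that come from `K`.
  let L : DirHypergraph C :=
    { V := Σ i, (H i).V
      finite_V := have := fun i => (H i).finite_V; inferInstance
      E := mapEdge F '' K.E ∪ ⋃ i, mapEdge (Sigma.mk i) '' (H i).E
      finite_E := (K.finite_E.image _).union (Set.finite_iUnion fun i => (H i).finite_E.image _)
      nodup := by
        rintro e' (⟨e, he, rfl⟩ | he')
        · exact (K.nodup e he).map hFinj
        · obtain ⟨i, e, he, rfl⟩ := Set.mem_iUnion.mp he'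
          exact ((H i).nodup e he).map sigma_mk_injective
      two_le_length := by
        rintro e' (⟨e, he, rfl⟩ | he')
        · simpa [mapEdge] using K.two_le_length e he
        · obtain ⟨i, e, he, rfl⟩ := Set.mem_iUnion.mp he'
          simpa [mapEdge] using (H i).two_le_length e he }
  refine ⟨L, ⟨Equiv.refl _, fun i e => ⟨fun h => ?_, ?_⟩⟩, F, hFinj, fun e => ⟨fun h => ?_, ?_⟩⟩
  · exact Or.inr (Set.mem_iUnion.mpr ⟨i, e, h, rfl⟩)
  · rintro (⟨e', he', h⟩ | h)
    · exact (key i e' e h).mp he'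
    · obtain ⟨j, e', he', h⟩ := Set.mem_iUnion.mp h
      have hij : i = j := by
        obtain ⟨x, hx⟩ := List.exists_mem_of_ne_nil _ (ne_nil_of_mem he')
        have : (⟨j, x⟩ : Σ i, (H i).V) ∈ (mapEdge (Sigma.mk j) e').1 := List.mem_map_of_mem hx
        rw [h] at this
        obtain ⟨y, -, hy⟩ := List.mem_map.mp this
        exact congrArg Sigma.fst hy
      subst hij
      rwa [← mapEdge_injective sigma_mk_injective h]
  · exact Or.inl ⟨e, h, rfl⟩
  · rintro (⟨e', he', h⟩ | h)
    · rwa [← mapEdge_injective hFinj h]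
    · obtain ⟨j, e', he', h⟩ := Set.mem_iUnion.mp h
      exact (key j e e' h.symm).mpr he'

theorem starJoin_subset_genProduct {ι : Type} (H : ι → DirHypergraph C) :
    starJoin H ⊆ genProduct fun i => Below (H i) := by
  rintro L ⟨φ, hφ⟩
  refine ⟨fun v => (φ.symm v).1, fun i => ?_⟩
  let g : (H i).V → (L.induce ((fun v => (φ.symm v).1) ⁻¹' {i})).V :=
    fun x => ⟨φ ⟨i, x⟩, by simp⟩
  have hg : Function.Bijective g := by
    constructor
    · intro x y h
      have h' : (⟨i, x⟩ : Σ i, (H i).V) = ⟨i, y⟩ := φ.injective (congrArg Subtype.val h)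
      exact sigma_mk_injective (β := fun i => (H i).V) h'
    · rintro ⟨v, rfl⟩
      exact ⟨(φ.symm v).2, Subtype.ext (φ.apply_symm_apply v)⟩
  have : IsIso (H i) _ (Equiv.ofBijective g hg) := by
    intro e
    rw [hφ]
    exact iff_of_eq (congrArg (· ∈ L.E) (mapEdge_mapEdge Subtype.val g e).symm)
  exact ⟨_, this.isEmb_symm⟩

/-- In the product a part may be smaller than `H i`, but it can be completed to a full join, and
closure under embeddings brings membership back down. -/
theorem starJoin_subset_iff {ι : Type} [Finite ι] {H : ι → DirHypergraph C}
    {P : Set (DirHypergraph C)} (hP : EmbClosed P) :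
    starJoin H ⊆ P ↔ (genProduct fun i => Below (H i)) ⊆ P := by
  refine ⟨fun h K hK => ?_, (starJoin_subset_genProduct H).trans⟩
  obtain ⟨L, hL, f, hf⟩ := exists_mem_starJoin hK
  exact hP hf (h hL)

/-! ### Copies -/

theorem mem_copies_E {k : ℕ} {G : DirHypergraph C} {e : List (Fin k × G.V) × C} :
    e ∈ (copies k G).E ↔
      (∀ x ∈ e.1, ∀ y ∈ e.1, x.1 = y.1) ∧ mapEdge Prod.snd e ∈ G.E := by
  constructor
  · intro h
    obtain ⟨j, e, he, rfl⟩ := Set.mem_iUnion.mp h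
    refine ⟨?_, by rw [mapEdge_mapEdge]; exact (mapEdge_id e).symm ▸ he⟩
    simp only [mapEdge, List.forall_mem_map, implies_true]
  · rintro ⟨h1, h2⟩
    obtain ⟨⟨j, v⟩, hx⟩ : ∃ x, x ∈ e.1 :=
      List.exists_mem_of_ne_nil _ fun h => ne_nil_of_mem h2 (by simp [mapEdge, h])
    refine Set.mem_iUnion.mpr ⟨j, _, h2, ?_⟩
    rw [mapEdge_mapEdge]
    refine Prod.ext ?_ rfl
    change e.1.map _ = e.1
    refine (List.map_congr_left fun y hy => ?_).trans (List.map_id _)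
    exact Prod.ext (h1 _ hx y hy) rfl

theorem isEmb_copies {k l : ℕ} {G H : DirHypergraph C} {σ : Fin k → Fin l} {f : G.V → H.V}
    (hσ : Function.Injective σ) (hf : IsEmb G H f) :
    IsEmb (copies k G) (copies l H) (Prod.map σ f) := by
  refine ⟨hσ.prodMap hf.1, fun e => ?_⟩
  refine (mem_copies_E.trans (and_congr ?_ ?_)).trans (mem_copies_E (e := mapEdge _ _)).symm
  · have h : ∀ m : List (Fin k × G.V), (∀ x ∈ m, ∀ y ∈ m, x.1 = y.1) ↔
        ∀ x ∈ m.map (Prod.map σ f), ∀ y ∈ m.map (Prod.map σ f), x.1 = y.1 := fun m => by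
      simp only [List.forall_mem_map, Prod.map_fst, hσ.eq_iff]
    exact h e.1
  · rw [hf.2]
    exact iff_of_eq (congrArg (· ∈ H.E) (mapEdge_mapEdge_eq
      (f := f) (g := Prod.snd) (f' := Prod.snd) (g' := Prod.map σ f) rfl e))

theorem isEmb_copies_one (G : DirHypergraph C) : IsEmb (copies 1 G) G Prod.snd :=
  ⟨fun _ _ h => Prod.ext (Subsingleton.elim _ _) h, fun _ => mem_copies_E.trans
    (and_iff_right fun _ _ _ _ => Subsingleton.elim _ _)⟩

theorem isEmb_prodMk {k : ℕ} (G : DirHypergraph C) (j : Fin k) :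
    IsEmb G (copies k G) (Prod.mk j) := by
  refine ⟨Prod.mk_right_injective j, fun e => Iff.symm ?_⟩
  refine (mem_copies_E (e := mapEdge _ _)).trans ((and_iff_right ?_).trans ?_)
  · simp only [mapEdge, List.forall_mem_map, implies_true]
  · rw [mapEdge_mapEdge]
    exact iff_of_eq (congrArg (· ∈ G.E) (mapEdge_id e))

theorem isEmb_inl (G H : DirHypergraph C) : IsEmb G (disjUnion G H) Sum.inl := by
  refine ⟨Sum.inl_injective, fun e => ⟨fun h => Or.inl ⟨e, h, rfl⟩, ?_⟩⟩
  rintro (⟨e', he, h⟩ | ⟨e', he, h⟩)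
  · rwa [← mapEdge_injective Sum.inl_injective h]
  · obtain ⟨x, hx⟩ := List.exists_mem_of_ne_nil _ (ne_nil_of_mem he)
    have : Sum.inr x ∈ (mapEdge (Sum.inr : H.V → G.V ⊕ H.V) e').1 := List.mem_map_of_mem hx
    rw [h] at this
    obtain ⟨y, -, hy⟩ := List.mem_map.mp this
    exact (Sum.inl_ne_inr hy).elim

theorem isEmb_inr (G H : DirHypergraph C) : IsEmb H (disjUnion G H) Sum.inr := by
  refine ⟨Sum.inr_injective, fun e => ⟨fun h => Or.inr ⟨e, h, rfl⟩, ?_⟩⟩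
  rintro (⟨e', he, h⟩ | ⟨e', he, h⟩)
  · obtain ⟨x, hx⟩ := List.exists_mem_of_ne_nil _ (ne_nil_of_mem he)
    have : Sum.inl x ∈ (mapEdge (Sum.inl : G.V → G.V ⊕ H.V) e').1 := List.mem_map_of_mem hx
    rw [h] at this
    obtain ⟨y, -, hy⟩ := List.mem_map.mp this
    exact (Sum.inr_ne_inl hy).elim
  · rwa [← mapEdge_injective Sum.inr_injective h]

/-- A map out of a disjoint union is an embedding if it is one on both sides and no edge meets the
images of both sides. -/
theorem isEmb_of_disjUnion {G H L : DirHypergraph C} {f : G.V ⊕ H.V → L.V}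
    (hf : Function.Injective f) (hl : IsEmb G L (f ∘ Sum.inl)) (hr : IsEmb H L (f ∘ Sum.inr))
    (hlr : ∀ e ∈ L.E, ∀ v w, f (Sum.inl v) ∈ e.1 → f (Sum.inr w) ∉ e.1) :
    IsEmb (disjUnion G H) L f := by
  refine ⟨hf, fun (e : List (G.V ⊕ H.V) × C) => ⟨?_, fun h => ?_⟩⟩
  · rintro (⟨e, he, rfl⟩ | ⟨e, he, rfl⟩)
    · exact (congrArg (· ∈ L.E) (mapEdge_mapEdge f Sum.inl e)).mpr ((hl.2 e).mp he)
    · exact (congrArg (· ∈ L.E) (mapEdge_mapEdge f Sum.inr e)).mpr ((hr.2 e).mp he)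
  · have hmem : ∀ x ∈ e.1, f x ∈ (mapEdge f e).1 := fun x hx => List.mem_map_of_mem hx
    by_cases hx : ∃ v, Sum.inl v ∈ e.1
    · obtain ⟨v, hv⟩ := hx
      obtain ⟨e, rfl⟩ : ∃ e', mapEdge Sum.inl e' = e := by
        refine exists_mapEdge_eq ?_
        rintro (w | w) hw
        · exact ⟨w, rfl⟩
        · exact (hlr _ h v w (hmem _ hv) (hmem _ hw)).elim
      exact Or.inl ⟨e, (hl.2 e).mpr
        ((congrArg (· ∈ L.E) (mapEdge_mapEdge f Sum.inl e)).mp h), rfl⟩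
    · obtain ⟨e, rfl⟩ : ∃ e', mapEdge Sum.inr e' = e := by
        refine exists_mapEdge_eq ?_
        rintro (w | w) hw
        · exact (hx ⟨w, hw⟩).elim
        · exact ⟨w, rfl⟩
      exact Or.inr ⟨e, (hr.2 e).mpr
        ((congrArg (· ∈ L.E) (mapEdge_mapEdge f Sum.inr e)).mp h), rfl⟩

theorem isIso_disjUnion_copies (k l : ℕ) (G : DirHypergraph C) :
    IsIso (disjUnion (copies k G) (copies l G)) (copies (k + l) G)
      ((Equiv.sumProdDistrib (Fin k) (Fin l) G.V).symm.trans
        (Equiv.prodCongr finSumFinEquiv (Equiv.refl G.V))) := by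
  refine (isEmb_of_disjUnion (Equiv.injective _)
    (isEmb_copies (Fin.castAdd_injective k l) (.refl G))
    (isEmb_copies (Fin.natAdd_injective l k) (.refl G)) ?_).2
  intro e he v w hv hw
  have h : Fin.castAdd l v.1 = Fin.natAdd k w.1 := (mem_copies_E.mp he).1 _ hv _ hw
  have := congrArg Fin.val h
  simp at this
  omega

theorem IsAdditiveIndHer.copies_mem {P : Set (DirHypergraph C)} (hP : IsAdditiveIndHer P)
    {G : DirHypergraph C} (hG : G ∈ P) (k : ℕ) : copies k G ∈ P := by
  induction k with
  | zero => exact hP.mem_of_isEmpty ⟨fun x => x.1.elim0⟩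
  | succ k ih =>
    exact hP.iso_closed _ _ _ (isIso_disjUnion_copies k 1 G)
      (hP.additive _ _ ih (hP.embClosed (isEmb_copies_one G) hG))

theorem isEmb_disjUnion {G₁ G₂ H₁ H₂ : DirHypergraph C} {f : G₁.V → H₁.V} {g : G₂.V → H₂.V}
    (hf : IsEmb G₁ H₁ f) (hg : IsEmb G₂ H₂ g) :
    IsEmb (disjUnion G₁ G₂) (disjUnion H₁ H₂) (Sum.map f g) := by
  refine isEmb_of_disjUnion (hf.1.sumMap hg.1) ((isEmb_inl H₁ H₂).comp hf)
    ((isEmb_inr H₁ H₂).comp hg) ?_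
  rintro _ (⟨e, he, rfl⟩ | ⟨e, he, rfl⟩) v w hv hw
  · obtain ⟨x, -, hx⟩ := List.mem_map.mp hw
    exact Sum.inl_ne_inr hx
  · obtain ⟨x, -, hx⟩ := List.mem_map.mp hv
    exact Sum.inr_ne_inl hx

/-! ### Strict hypergraphs and decompositions -/

theorem strict_iff {P : Set (DirHypergraph C)} (hP : EmbClosed P) {G : DirHypergraph C} :
    G ∈ strict P ↔ G ∈ P ∧ ¬ (genProduct fun i => Below (![G, single C] i)) ⊆ P := by
  rw [← starJoin_subset_iff hP]
  rfl

theorem strict_of_isEmb {P : Set (DirHypergraph C)} (hP : EmbClosed P)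
    {G H : DirHypergraph C} {f : G.V → H.V} (hf : IsEmb G H f) (hG : G ∈ strict P)
    (hH : H ∈ P) : H ∈ strict P := by
  rw [strict_iff hP] at hG ⊢
  refine ⟨hH, fun h => hG.2 (Set.Subset.trans (genProduct_mono fun i => ?_) h)⟩
  fin_cases i
  · exact Below_subset (embClosed_Below H) ⟨f, hf⟩
  · exact subset_rfl

/-- An unused colour `i₀` could be given to a vertex attached to `G` in any way, as `single C ∈ R
i₀`. All of `G * K₁` would then lie in `P`, against strictness. -/
theorem surjective_of_strict {P : Set (DirHypergraph C)} (hP : EmbClosed P) {ι : Type}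
    {R : ι → Set (DirHypergraph C)} (hR : ∀ i, EmbClosed (R i)) (h1 : ∀ i, single C ∈ R i)
    (hRP : genProduct R ⊆ P) {G : DirHypergraph C} (hG : G ∈ strict P) {c : G.V → ι}
    (hc : ∀ i, G.induce (c ⁻¹' {i}) ∈ R i) : Function.Surjective c := by
  classical
  intro i₀
  by_contra! hi₀
  refine ((strict_iff hP).mp hG).2 (Set.Subset.trans ?_ hRP)
  rintro K ⟨d, hd⟩
  obtain ⟨f, hf⟩ := hd 0
  obtain ⟨g, hg⟩ := hd 1
  refine ⟨fun v => if h : d v = 0 then c (f ⟨v, h⟩) else i₀, fun i => ?_⟩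
  by_cases hi : i = i₀
  · subst hi
    have h2 : ∀ v : (K.induce ((fun v => if h : d v = 0 then c (f ⟨v, h⟩) else i) ⁻¹' {i})).V,
        v.1 ∈ d ⁻¹' {1} := by
      rintro ⟨v, hv⟩
      by_cases h : d v = 0
      · simp only [Set.mem_preimage, h, dite_true, Set.mem_singleton_iff] at hv
        exact (hi₀ _ hv).elim
      · exact Fin.eq_one_of_ne_zero _ h
    -- `c` misses this colour, so the part consists of added vertices only and embeds into `K₁`.
    exact hR i (hg.comp ((isEmb_val K _).codRestrict h2)) (h1 i)
  · have h2 : ∀ v : (K.induce ((fun v => if h : d v = 0 then c (f ⟨v, h⟩) else i₀) ⁻¹' {i})).V,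
        ∃ h : v.1 ∈ d ⁻¹' {0}, f ⟨v.1, h⟩ ∈ c ⁻¹' {i} := by
      rintro ⟨v, hv⟩
      by_cases h : d v = 0
      · simp only [Set.mem_preimage, h, dite_true, Set.mem_singleton_iff] at hv
        exact ⟨h, hv⟩
      · simp only [Set.mem_preimage, h, dite_false, Set.mem_singleton_iff] at hv
        exact (hi hv.symm).elim
    exact hR i (((hf.comp ((isEmb_val K _).codRestrict fun v => (h2 v).1))).codRestrict
      (B := c ⁻¹' {i}) fun v => (h2 v).2) (hc i)

theorem isDecomposition_iff {P : Set (DirHypergraph C)} (hP : EmbClosed P)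
    {G : DirHypergraph C} {n : ℕ} {c : G.V → Fin n} :
    IsDecomposition P G c ↔ Function.Surjective c ∧ ∀ k : ℕ, 0 < k →
      (genProduct fun i => Below (copies k (G.induce (c ⁻¹' {i})))) ⊆ P :=
  and_congr Iff.rfl (forall₂_congr fun _ _ => starJoin_subset_iff hP)

/-- Decompositions restrict to strict induced subhypergraphs. -/
theorem IsDecomposition.comp_isEmb {P : Set (DirHypergraph C)} (hP : EmbClosed P)
    {G H : DirHypergraph C} {f : G.V → H.V} (hf : IsEmb G H f) (hG : G ∈ strict P) {n : ℕ}
    {c : H.V → Fin n} (hc : IsDecomposition P H c) : IsDecomposition P G (c ∘ f) := by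
  rw [isDecomposition_iff hP] at hc ⊢
  have hm : ∀ i, IsEmb (G.induce ((c ∘ f) ⁻¹' {i})) (H.induce (c ⁻¹' {i}))
      (Set.MapsTo.restrict f ((c ∘ f) ⁻¹' {i}) (c ⁻¹' {i}) fun _ h => h) :=
    fun i => hf.induce _
  -- Strictness of `G` keeps all parts nonempty; the case `k = 1` supplies the product inside `P`
  -- that this needs.
  refine ⟨surjective_of_strict hP (fun i => embClosed_Below _) (fun i => ?_) (hc.2 1 one_pos) hG
    fun i => ?_, fun k hk => Set.Subset.trans (genProduct_mono fun i => ?_) (hc.2 k hk)⟩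
  · obtain ⟨v, hv⟩ := hc.1 i
    exact ⟨_, isEmb_single ((0 : Fin 1), ⟨v, hv⟩)⟩
  · exact ⟨_, (isEmb_prodMk _ 0).comp (hm i)⟩
  · exact Below_subset (embClosed_Below _) ⟨_, isEmb_copies Function.injective_id (hm i)⟩

/-! ### Bounds for `dec` -/

theorem bddAbove_decomposition (P : Set (DirHypergraph C)) (G : DirHypergraph C) :
    BddAbove {n : ℕ | ∃ c : G.V → Fin n, IsDecomposition P G c} := by
  have := G.finite_V
  refine ⟨Nat.card G.V, ?_⟩
  rintro n ⟨c, hc⟩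
  simpa using Nat.card_le_card_of_surjective c hc.1

theorem IsDecomposition.le_decNumber {P : Set (DirHypergraph C)} {G : DirHypergraph C} {n : ℕ}
    {c : G.V → Fin n} (hc : IsDecomposition P G c) : n ≤ decNumber P G :=
  le_csSup (bddAbove_decomposition P G) ⟨c, hc⟩

/-- A factorisation decomposes every strict hypergraph. -/
theorem exists_isDecomposition {P : Set (DirHypergraph C)} (hP : EmbClosed P) {ι : Type}
    [Fintype ι] {R : ι → Set (DirHypergraph C)} (hR : ∀ i, IsAdditiveIndHer (R i))
    (hPR : P = genProduct R) {G : DirHypergraph C} (hG : G ∈ strict P) :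
    ∃ c : G.V → Fin (Fintype.card ι), IsDecomposition P G c := by
  rw [← genProduct_comp_equiv (Fintype.equivFin ι).symm] at hPR
  obtain ⟨c, hc⟩ := hPR.subset hG.1
  refine ⟨c, (isDecomposition_iff hP).mpr ⟨surjective_of_strict hP
    (fun i => (hR _).embClosed) (fun i => (hR _).single_mem) hPR.superset hG hc,
    fun k _ => Set.Subset.trans (genProduct_mono fun i => ?_) hPR.superset⟩⟩
  exact Below_subset (hR _).embClosed ((hR _).copies_mem (hc i) k)

/-- Without strict members, `P` would be closed under attaching one vertex in any way, and induction
on the number of vertices would put every hypergraph in `P`. -/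
theorem strict_nonempty {P : Set (DirHypergraph C)} (hP : IsAdditiveIndHer P)
    (h : P ≠ Set.univ) : (strict P).Nonempty := by
  classical
  by_contra! hs
  refine h (Set.eq_univ_of_forall fun G => ?_)
  induction hn : Nat.card G.V generalizing G with
  | zero =>
    have := G.finite_V
    exact hP.mem_of_isEmpty (Finite.card_eq_zero_iff.mp hn)
  | succ n ih =>
    have := G.finite_V
    obtain ⟨v⟩ : Nonempty G.V := Finite.card_pos_iff.mp (by omega)
    have hv : G.induce {v}ᶜ ∈ P := by
      refine ih _ ?_
      change Nat.card ({v}ᶜ : Set G.V) = n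
      have := Set.ncard_compl ({v} : Set G.V)
      rw [Set.ncard_singleton, hn] at this
      simpa using this
    have h1 : G.induce {v}ᶜ ∉ strict P := by simp [hs]
    rw [strict_iff hP.embClosed] at h1
    push Not at h1
    refine h1 hv ⟨fun x => if x = v then 1 else 0, fun i => ?_⟩
    fin_cases i
    · refine ⟨_, (isEmb_val G _).codRestrict ?_⟩
      rintro ⟨x, hx⟩
      simpa using hx
    · have h2 : ∀ x : (G.induce ((fun x => if x = v then (1 : Fin 2) else 0) ⁻¹' {1})).V,
          x.1 = v := by
        rintro ⟨x, hx⟩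
        simpa using hx
      let x₀ : (G.induce ((fun x => if x = v then (1 : Fin 2) else 0) ⁻¹' {1})).V :=
        ⟨v, by simp⟩
      let φ : (single C).V ≃ (G.induce ((fun x => if x = v then (1 : Fin 2) else 0) ⁻¹' {1})).V :=
        { toFun := fun _ => x₀
          invFun := fun _ => ()
          left_inv := fun _ => rfl
          right_inv := fun x => Subtype.ext (h2 x).symm }
      exact ⟨_, IsIso.isEmb_symm (φ := φ) (isEmb_single x₀).2⟩

theorem card_le_dec {P : Set (DirHypergraph C)} (hP : IsAdditiveIndHer P) (h : P ≠ Set.univ)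
    {ι : Type} [Fintype ι] {R : ι → Set (DirHypergraph C)} (hR : ∀ i, IsAdditiveIndHer (R i))
    (hPR : P = genProduct R) : Fintype.card ι ≤ dec P := by
  obtain ⟨G, hG, hGd⟩ := Nat.sInf_mem ((strict_nonempty hP h).image (decNumber P))
  rw [dec, ← hGd]
  obtain ⟨c, hc⟩ := exists_isDecomposition hP.embClosed hR hPR hG
  exact hc.le_decNumber

theorem one_le_dec {P : Set (DirHypergraph C)} (hP : IsAdditiveIndHer P) (h : P ≠ Set.univ) :
    1 ≤ dec P := by
  simpa using card_le_dec hP h (fun _ : Unit => hP) (genProduct_const hP.embClosed).symm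

/-- Some strict hypergraph has the property that all larger members of `P` have a decomposition
with exactly `dec P` parts. -/
theorem exists_strict_dec {P : Set (DirHypergraph C)} (hP : IsAdditiveIndHer P)
    (h : P ≠ Set.univ) : ∃ G ∈ strict P, ∀ H ∈ P, G ∈ Below H →
      ∃ c : H.V → Fin (dec P), IsDecomposition P H c := by
  obtain ⟨G, hG, hGd⟩ := Nat.sInf_mem ((strict_nonempty hP h).image (decNumber P))
  refine ⟨G, hG, ?_⟩
  rintro H hH ⟨f, hf⟩
  have hHs := strict_of_isEmb hP.embClosed hf hG hH
  obtain ⟨c₁, hc₁⟩ := exists_isDecomposition hP.embClosed (fun _ : Unit => hP)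
    (genProduct_const hP.embClosed).symm hHs
  obtain ⟨c, hc⟩ := Nat.sSup_mem
    (s := {n : ℕ | ∃ c : H.V → Fin n, IsDecomposition P H c}) ⟨_, c₁, hc₁⟩ (bddAbove_decomposition P H)
  -- `H` is strict, so minimality bounds its number from below; restricting an optimal decomposition
  -- of `H` to `G` bounds it from above.
  have h1 : decNumber P H = dec P := by
    refine le_antisymm ?_ (Nat.sInf_le ⟨H, hHs, rfl⟩)
    refine le_trans ?_ hGd.le
    exact (hc.comp_isEmb hP.embClosed hf hG).le_decNumber
  rw [← h1]
  exact ⟨c, hc⟩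

/-! ### Generated properties -/

/-- The closure of a class under induced subhypergraphs and disjoint unions. -/
inductive AddHerClosure (B : Set (DirHypergraph C)) : DirHypergraph C → Prop
  | base {G : DirHypergraph C} : G ∈ B → AddHerClosure B G
  | sub {G H : DirHypergraph C} {f : G.V → H.V} :
      IsEmb G H f → AddHerClosure B H → AddHerClosure B G
  | union {G H : DirHypergraph C} :
      AddHerClosure B G → AddHerClosure B H → AddHerClosure B (disjUnion G H)

theorem isAdditiveIndHer_addHerClosure {B : Set (DirHypergraph C)}
    (hB : ∃ G ∈ B, Nonempty G.V) : IsAdditiveIndHer {G | AddHerClosure B G} where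
  nontrivial := by
    obtain ⟨G, hG, h⟩ := hB
    exact ⟨G, .base hG, h⟩
  iso_closed _ _ _ h hG := .sub h.isEmb_symm hG
  hereditary _ _ h hH := by
    obtain ⟨f, hf⟩ := isInducedSub_iff.mp h
    exact .sub hf hH
  additive _ _ := .union

/-- A member of the class generated by the `i`-coloured parts of the members of `P` only involves
finitely many members of `P`. -/
theorem exists_finset_of_addHerClosure {P : Set (DirHypergraph C)} {n : ℕ}
    {c : ∀ G : P, G.1.V → Fin n} {i : Fin n} {K : DirHypergraph C}
    (hK : AddHerClosure {X | ∃ G : P, X = G.1.induce (c G ⁻¹' {i})} K) :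
    ∃ s : Finset P, ∀ (H : DirHypergraph C) (d : H.V → Fin n),
      (∀ G ∈ s, ∃ f, IsEmb G.1 H f ∧ d ∘ f = c G) →
      ∃ k, K ∈ Below (copies k (H.induce (d ⁻¹' {i}))) := by
  classical
  induction hK with
  | base h =>
    obtain ⟨G, rfl⟩ := h
    refine ⟨{G}, fun H d hH => ⟨1, ?_⟩⟩
    obtain ⟨f, hf, hfd⟩ := hH G (Finset.mem_singleton_self G)
    exact ⟨_, (isEmb_prodMk _ 0).comp (hf.induce (B := d ⁻¹' {i}) fun v hv =>
      (congrFun hfd v).trans hv)⟩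
  | sub hf _ ih =>
    obtain ⟨s, hs⟩ := ih
    refine ⟨s, fun H d hH => ?_⟩
    obtain ⟨k, hk⟩ := hs H d hH
    exact ⟨k, embClosed_Below _ hf hk⟩
  | union _ _ ih₁ ih₂ =>
    obtain ⟨s, hs⟩ := ih₁
    obtain ⟨t, ht⟩ := ih₂
    refine ⟨s ∪ t, fun H d hH => ?_⟩
    obtain ⟨k, f, hf⟩ := hs H d fun G hG => hH G (Finset.mem_union_left t hG)
    obtain ⟨l, g, hg⟩ := ht H d fun G hG => hH G (Finset.mem_union_right s hG)
    exact ⟨k + l, _, (isIso_disjUnion_copies k l _).isEmb.comp (isEmb_disjUnion hf hg)⟩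

theorem IsAdditiveIndHer.exists_upper_bound {P : Set (DirHypergraph C)}
    (hP : IsAdditiveIndHer P) (s : Finset P) : ∃ H ∈ P, ∀ G ∈ s, G.1 ∈ Below H := by
  classical
  induction s using Finset.induction with
  | empty => exact ⟨_, hP.single_mem, by simp⟩
  | insert G s _ ih =>
    obtain ⟨H, hH, h⟩ := ih
    refine ⟨_, hP.additive _ _ G.2 hH, fun G' hG' => ?_⟩
    rcases Finset.mem_insert.mp hG' with rfl | hG'
    · exact ⟨_, isEmb_inl _ _⟩
    · exact Below_subset (embClosed_Below _) ⟨_, isEmb_inr _ _⟩ (h G' hG')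

/-- Compactness: the members of `P` can be coloured simultaneously so that every finite family of
them embeds, with its colours, into a decomposed hypergraph. -/
theorem exists_coherent_colouring {P : Set (DirHypergraph C)} (hP : IsAdditiveIndHer P)
    (h : P ≠ Set.univ) :
    ∃ c : ∀ G : P, G.1.V → Fin (dec P), ∀ s : Finset P,
      ∃ (H : DirHypergraph C) (d : H.V → Fin (dec P)), IsDecomposition P H d ∧
        ∀ G ∈ s, ∃ f, IsEmb G.1 H f ∧ d ∘ f = c G := by
  classical
  have hpos := one_le_dec hP h
  obtain ⟨G₀, hG₀, hdec⟩ := exists_strict_dec hP h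
  have key : ∀ s : Finset P, ∃ c : ∀ G : P, G.1.V → Fin (dec P),
      ∃ (H : DirHypergraph C) (d : H.V → Fin (dec P)), IsDecomposition P H d ∧
        ∀ G ∈ s, ∃ f, IsEmb G.1 H f ∧ d ∘ f = c G := by
    intro s
    -- Including `G₀` guarantees that `H` has a decomposition with `dec P` parts.
    obtain ⟨H, hH, hs⟩ := hP.exists_upper_bound (insert ⟨G₀, hG₀.1⟩ s)
    obtain ⟨d, hd⟩ := hdec H hH (hs _ (Finset.mem_insert_self _ _))
    -- Members of `P` that do not embed into `H` get an arbitrary constant colour, which exists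
    -- because `dec P` is positive.
    refine ⟨fun G => if hG : G.1 ∈ Below H then d ∘ hG.choose else fun _ => ⟨0, hpos⟩, H, d, hd,
      fun G hG => ?_⟩
    have hG' := hs G (Finset.mem_insert_of_mem hG)
    exact ⟨hG'.choose, hG'.choose_spec, by simp only [hG', dite_true]⟩
  choose c hc using key
  let F : Ultrafilter (Finset P) := Ultrafilter.of Filter.atTop
  -- A finite hypergraph has finitely many colourings, so one of them is chosen for `F`-almost all
  -- `s`.
  have hlim : ∀ G : P, ∃ cG : G.1.V → Fin (dec P), ∀ᶠ s in (F : Filter (Finset P)), c s G = cG := by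
    intro G
    have := G.1.finite_V
    obtain ⟨cG, hcG⟩ := Ultrafilter.eq_pure_of_finite (F.map fun s => c s G)
    refine ⟨cG, ?_⟩
    have : {cG} ∈ F.map fun s => c s G := by
      rw [hcG]
      exact rfl
    exact this
  choose cl hcl using hlim
  refine ⟨cl, fun s => ?_⟩
  have h1 : ∀ᶠ t in (F : Filter (Finset P)), ∀ G ∈ s, c t G = cl G :=
    (Filter.eventually_all_finset s).mpr fun G _ => hcl G
  have h2 : ∀ᶠ t in (F : Filter (Finset P)), s ⊆ t :=
    Ultrafilter.of_le _ (Filter.eventually_ge_atTop s)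
  obtain ⟨t, ht1, ht2⟩ := (h1.and h2).exists
  obtain ⟨H, d, hd, hH⟩ := hc t
  refine ⟨H, d, hd, fun G hG => ?_⟩
  rw [← ht1 G hG]
  exact hH G (ht2 hG)

/-! ### Factorisation and indecomposability -/

/-- Every proper additive induced-hereditary property is a product of `dec P` such properties. -/
theorem exists_factorisation {P : Set (DirHypergraph C)} (hP : IsAdditiveIndHer P)
    (h : P ≠ Set.univ) : ∃ Q : Fin (dec P) → Set (DirHypergraph C),
      (∀ i, IsAdditiveIndHer (Q i)) ∧ P = product Q := by
  classical
  obtain ⟨c, hc⟩ := exists_coherent_colouring hP h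
  refine ⟨fun i => {K | AddHerClosure {X | ∃ G : P, X = G.1.induce (c G ⁻¹' {i})} K},
    fun i => isAdditiveIndHer_addHerClosure ?_, Set.Subset.antisymm ?_ ?_⟩
  · obtain ⟨G, hG⟩ := strict_nonempty hP h
    obtain ⟨H, d, hd, hH⟩ := hc {⟨G, hG.1⟩}
    obtain ⟨f, hf, hfd⟩ := hH _ (Finset.mem_singleton_self _)
    -- A strict member meets every colour, so each generated class has a non-null member.
    have h1 := (hd.comp_isEmb hP.embClosed hf hG).1 i
    rw [hfd] at h1
    exact ⟨_, ⟨⟨G, hG.1⟩, rfl⟩, h1.to_subtype⟩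
  · exact fun G hG => ⟨c ⟨G, hG⟩, fun i => .base ⟨⟨G, hG⟩, rfl⟩⟩
  · rintro K ⟨a, ha⟩
    choose s hs using fun i => exists_finset_of_addHerClosure (ha i)
    obtain ⟨H, d, hd, hH⟩ := hc (Finset.univ.biUnion s)
    choose k hk using fun i => hs i H d fun G hG =>
      hH G (Finset.mem_biUnion.mpr ⟨i, Finset.mem_univ i, hG⟩)
    -- One number of copies serves all parts; adding 1 makes it positive, as decompositions require.
    refine ((isDecomposition_iff hP.embClosed).mp hd).2 (Finset.univ.sup k + 1) (Nat.succ_pos _)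
      ⟨a, fun i => ?_⟩
    have hle : k i ≤ Finset.univ.sup k + 1 :=
      (Finset.le_sup (Finset.mem_univ i)).trans (Nat.le_succ _)
    exact Below_subset (embClosed_Below _)
      ⟨_, isEmb_copies (Fin.castLE_injective hle) (.refl _)⟩ (hk i)

theorem indecomposable_of_factorisation {P : Set (DirHypergraph C)} (hP : IsAdditiveIndHer P)
    (h : P ≠ Set.univ) (Q : Fin (dec P) → Set (DirHypergraph C))
    (hQ : ∀ i, IsAdditiveIndHer (Q i)) (hPQ : P = product Q) (i : Fin (dec P)) :
    Indecomposable (Q i) := by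
  -- If some factor contained everything, colouring all vertices `j` and leaving the other parts
  -- empty would put every hypergraph in `P`.
  have hproper : ∀ j, Q j ≠ Set.univ := by
    intro j hj
    refine h (Set.eq_univ_of_forall fun G => ?_)
    rw [hPQ]
    refine ⟨fun _ => j, fun l => ?_⟩
    by_cases hl : l = j
    · rw [hl, hj]
      trivial
    · refine (hQ l).mem_of_isEmpty ⟨?_⟩
      rintro ⟨v, hv⟩
      exact hl (Eq.symm hv)
  choose R hR hQR using fun j => exists_factorisation (hQ j) (hproper j)
  have h1 : P = genProduct (fun x : Σ j, Fin (dec (Q j)) => R x.1 x.2) := by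
    rw [genProduct_sigma R fun j l => (hR j l).embClosed]
    refine hPQ.trans ?_
    exact congrArg genProduct (funext hQR)
  have h2 := card_le_dec hP h (fun x : Σ j, Fin (dec (Q j)) => hR x.1 x.2) h1
  rw [Fintype.card_sigma] at h2
  simp only [Fintype.card_fin] at h2
  have h3 : ∀ j ∈ Finset.univ, 1 ≤ dec (Q j) := fun j _ => one_le_dec (hQ j) (hproper j)
  -- Both sums lie between `dec P` and `dec P`, so the termwise inequality 1 ≤ `dec (Q j)` is an
  -- equality throughout.
  have h4 : ∑ j : Fin (dec P), 1 = ∑ j, dec (Q j) :=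
    le_antisymm (Finset.sum_le_sum h3) (by simpa using h2)
  exact ((Finset.sum_eq_sum_iff_of_le h3).mp h4 i (Finset.mem_univ i)).symm

end DirHypergraph

theorem mainTheorem3 {C : Type*} (P : Set (DirHypergraph C))
    (hP : DirHypergraph.IsAdditiveIndHer P) (hP_proper : P ≠ Set.univ) :
    (∃ Q : Fin (DirHypergraph.dec P) → Set (DirHypergraph C),
        (∀ i, DirHypergraph.IsAdditiveIndHer (Q i)) ∧
        (∀ i, DirHypergraph.Indecomposable (Q i)) ∧
        P = DirHypergraph.product Q) ∧
      ∀ Q : Fin (DirHypergraph.dec P) → Set (DirHypergraph C),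
        (∀ i, DirHypergraph.IsAdditiveIndHer (Q i)) →
        P = DirHypergraph.product Q →
        ∀ i, DirHypergraph.Indecomposable (Q i) := by
  obtain ⟨Q, hQ, hPQ⟩ := DirHypergraph.exists_factorisation hP hP_proper
  have key := DirHypergraph.indecomposable_of_factorisation hP hP_proper
  exact ⟨⟨Q, hQ, key Q hQ hPQ, hPQ⟩, key⟩
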